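/- For $a\in\mathbb{C}$ and $n\in\mathbb{Z}$ let $(a)_n=a(a+1)\cdots(a+n-1)$ if $n\ge 0$ and $(a)_{n}=\dfrac{1}{(a-1)(a-2)\cdots(a-|n|)}$ if $n<0$ (so that $1/(a)_n=(a-1)\cdots(a-|n|)$ for $n<0$, also when this product vanishes), and let $${}_2H_2\left[\begin{matrix} a, b;\\ c, d;\end{matrix}\; z\right]=\sum_{n=-\infty}^{\infty}\frac{(a)_n(b)_n}{(c)_n(d)_n}\,z^n$$ be the bilateral hypergeometric series, where the sum is the limit of $\sum_{n=M}^{N}$ as $M\to-\infty$ and $N\to\infty$ independently. Let $a,c\in\mathbb{C}$ be such that $2a\notin\{1,2,3,\dots\}$ and $2c\notin\{0,-1,-2,\dots\}$ (so that all terms below are defined), and $\operatorname{Re}(c-a)>0$. Then the series ${}_2H_2\left[\begin{matrix} a, a+\frac12;\\ c, c+\frac12;\end{matrix}\; -1\right]$ converges, and $${}_2H_2\left[\begin{matrix} a, a+\tfrac12;\\ c, c+\tfrac12;\end{matrix}\; -1\right]=\frac{\Gamma(2c)\,\Gamma(1-2a)}{\Gamma(2c-2a)}\;2^{\,c-a-\frac12}\;\cos\left(\frac{2c+2a-1}{4}\,\pi\right).$$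 -/

import Mathlib

/-- The Pochhammer symbol `(a)_n` with an integer index:
`(a)_n = a (a+1) ⋯ (a+n-1)` for `n ≥ 0` and `(a)_{-n} = 1 / ((a-1) (a-2) ⋯ (a-n))` for `n > 0`
(the denominator is the rising factorial `(a-n)_n`). When `a ∉ ℤ` this is `Γ(a+n) / Γ(a)`. -/
noncomputable def intPochhammer (a : ℂ) : ℤ → ℂ
  | Int.ofNat n => (ascPochhammer ℂ n).eval a
  | Int.negSucc n => ((ascPochhammer ℂ (n + 1)).eval (a - ((n + 1 : ℕ) : ℂ)))⁻¹

/-- The `n`-th term of the bilateral hypergeometric series `₂H₂[a, b; c, d; z]`.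
For `n > 0` the term of index `-n` is `(1-c)_n (1-d)_n / ((1-a)_n (1-b)_n) * z ^ (-n)`; in particular
it vanishes, as it should, when `c` or `d` is one of `1, …, n` (then `1 / (c)_{-n} = (c-n)_n = 0`,
which is also what inverting `0⁻¹ = 0` gives here). Meaningful if neither `c` nor `d` is a
nonpositive integer and neither `a` nor `b` is a positive integer. -/
noncomputable def bilateralTerm (a b c d z : ℂ) (n : ℤ) : ℂ :=
  intPochhammer a n * intPochhammer b n / (intPochhammer c n * intPochhammer d n) * z ^ n

/-- The bilateral hypergeometric series `₂H₂[a, b; c, d; z] = ∑_{n = -∞}^{∞} (a)_n (b)_n / ((c)_n (d)_n) z^n`,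
as the limit of the sums over `M ≤ n ≤ N` when `M → -∞` and `N → ∞` independently. -/
noncomputable def bilateralH (a b c d z : ℂ) : ℂ :=
  ∑'[SummationFilter.conditional ℤ] n : ℤ, bilateralTerm a b c d z n

open MeasureTheory Set Filter Topology

/-! ### Integrability and recurrence for Cauchy's beta integral. -/

section CosineIntegral

/-! By the duplication formula the `n`-th term is a constant times `(-1)^n / (Γ(2c+2n) Γ(1-2a-2n))`.
Cauchy's beta integral (`cosIntegral_eq`) turns this reciprocal Gamma product into the Fourier
coefficient at frequency `4n` of one function `f(t) = (2 cos t)^(s-1) e^{2ixt}` on `[-π/2, π/2]`,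
with `s = 2c-2a` and `x = (2c+2a-1)/2` (`bilateralTerm_eq_cosIntegral`). Formally `∑ (-1)^n
e^{4int}` is a comb of point masses at `t = ±π/4`, so the series picks out `f(π/4) + f(-π/4)`, which
gives the power of 2 and the cosine.

Since `f` may be unbounded at the endpoints, this is made rigorous by writing `f = A + B e^{2it} + g
(1 + e^{4it})` with `g` integrable (`exists_integrable_quotient`). The `A` part contributes only at
`n = 0`, the `B` part never, and the `g` part telescopes with boundary terms that vanish by
Riemann–Lebesgue (`hasSum_cosIntegral`).

The beta integral itself comes from a recurrence `s → s+2`, iterated to infinity: the integrals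
concentrate at `t = 0`, and the accumulated factors are Euler products for Gamma. -/

theorem integrableOn_cos_rpow {r : ℝ} (hr : 0 < r) :
    IntegrableOn (fun t : ℝ => Real.cos t ^ (r - 1)) (Ioo (-(Real.pi / 2)) (Real.pi / 2)) := by
  have hcont : Continuous fun t : ℝ => Real.cos t ^ r :=
    Real.continuous_cos.rpow_const fun _ => Or.inr hr.le
  have hcos : ∀ t ∈ Ioo (-(Real.pi / 2)) (Real.pi / 2), 0 < Real.cos t := fun t ht =>
    Real.cos_pos_of_mem_Ioo ht
  -- The derivative of `t - sin t cos^r t` is nonnegative, hence integrable; it contains `r sin² t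
  -- cos^(r-1) t`, from which `cos^(r-1)` is recovered via `sin² + cos² = 1`.
  have h1 : IntegrableOn (fun t : ℝ => 1 - (Real.cos t * Real.cos t ^ r
      + Real.sin t * (-Real.sin t * r * Real.cos t ^ (r - 1))))
      (Ioc (-(Real.pi / 2)) (Real.pi / 2)) := by
    refine intervalIntegral.integrableOn_deriv_of_nonneg
      (g := fun t => t - Real.sin t * Real.cos t ^ r) (by fun_prop) (fun t ht => ?_) fun t ht => ?_
    · exact (hasDerivAt_id t).sub ((Real.hasDerivAt_sin t).mul
        ((Real.hasDerivAt_cos t).rpow_const (Or.inl (hcos t ht).ne')))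
    · have h0 := hcos t ht
      have h2 : Real.cos t ^ r ≤ 1 := Real.rpow_le_one h0.le (Real.cos_le_one t) hr.le
      have h3 : 0 ≤ Real.cos t ^ r := Real.rpow_nonneg h0.le _
      have h4 : Real.cos t * Real.cos t ^ r ≤ 1 := mul_le_one₀ (Real.cos_le_one t) h3 h2
      have h5 : 0 ≤ r * Real.cos t ^ (r - 1) * Real.sin t ^ 2 := by positivity
      nlinarith
  have h2 : IntegrableOn (fun t : ℝ => Real.cos t * Real.cos t ^ r)
      (Ioo (-(Real.pi / 2)) (Real.pi / 2)) :=
    ((Real.continuous_cos.mul hcont).integrableOn_Icc).mono_set Ioo_subset_Icc_self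
  have h3 : IntegrableOn (fun _ : ℝ => (1 : ℝ)) (Ioo (-(Real.pi / 2)) (Real.pi / 2)) :=
    integrableOn_const (by simp)
  have h5 : IntegrableOn (fun t : ℝ => r⁻¹ * (1 - (Real.cos t * Real.cos t ^ r
      + Real.sin t * (-Real.sin t * r * Real.cos t ^ (r - 1))) - 1 + Real.cos t * Real.cos t ^ r)
      + Real.cos t * Real.cos t ^ r) (Ioo (-(Real.pi / 2)) (Real.pi / 2)) :=
    ((((h1.mono_set Ioo_subset_Ioc_self).sub h3).add h2).const_mul r⁻¹).add h2
  refine h5.congr_fun (fun t ht => ?_) measurableSet_Ioo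
  have h0 := hcos t ht
  have h4 : Real.cos t ^ r = Real.cos t ^ (r - 1) * Real.cos t := by
    rw [← Real.rpow_add_one h0.ne']; ring_nf
  simp only [h4]
  field_simp
  linear_combination (r * Real.cos t ^ (r - 1)) * Real.cos_sq_add_sin_sq t

/-- The integrand `(2 cos t)^(s-1) e^{2ixt}` of Cauchy's beta integral. -/
noncomputable def cosKernel (s x : ℂ) (t : ℝ) : ℂ :=
  ((2 * Real.cos t : ℝ) : ℂ) ^ (s - 1) * Complex.exp (2 * Complex.I * x * t)

/-- Cauchy's beta integral `∫ (2 cos t)^(s-1) e^{2ixt} dt` over `[-π/2, π/2]`. -/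
noncomputable def cosIntegral (s x : ℂ) : ℂ :=
  ∫ t in (-(Real.pi / 2))..(Real.pi / 2), cosKernel s x t

theorem hasDerivAt_two_cos_cpow (s : ℂ) {t : ℝ} (ht : 0 < Real.cos t) :
    HasDerivAt (fun t : ℝ => ((2 * Real.cos t : ℝ) : ℂ) ^ s)
      (s * ((2 * Real.cos t : ℝ) : ℂ) ^ (s - 1) * ((2 * -Real.sin t : ℝ) : ℂ)) t := by
  have h := ((Real.hasDerivAt_cos t).const_mul 2).ofReal_comp
  have hslit : ((2 * Real.cos t : ℝ) : ℂ) ∈ Complex.slitPlane :=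
    Complex.ofReal_mem_slitPlane.2 (by positivity)
  have h2 := (hasDerivAt_id _).cpow_const (c := s) hslit
  rw [mul_one] at h2
  exact h2.comp t h

theorem hasDerivAt_exp_two_I (x : ℂ) (t : ℝ) :
    HasDerivAt (fun t : ℝ => Complex.exp (2 * Complex.I * x * t))
      (Complex.exp (2 * Complex.I * x * t) * (2 * Complex.I * x)) t := by
  have h := ((hasDerivAt_id t).ofReal_comp.const_mul (2 * Complex.I * x)).cexp
  simpa using h

theorem differentiableAt_cosKernel (s x : ℂ) {t : ℝ} (ht : 0 < Real.cos t) :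
    DifferentiableAt ℝ (cosKernel s x) t :=
  ((hasDerivAt_two_cos_cpow (s - 1) ht).mul (hasDerivAt_exp_two_I x t)).differentiableAt

theorem integrableOn_cosKernel {s : ℂ} (hs : 0 < s.re) (x : ℂ) :
    IntegrableOn (cosKernel s x) (Icc (-(Real.pi / 2)) (Real.pi / 2)) := by
  have hpow : IntegrableOn (fun t : ℝ => ((2 * Real.cos t : ℝ) : ℂ) ^ (s - 1))
      (Ioo (-(Real.pi / 2)) (Real.pi / 2)) := by
    refine Integrable.mono' ((integrableOn_cos_rpow hs).const_mul (2 ^ (s.re - 1)))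
      (ContinuousOn.aestronglyMeasurable (fun t ht => ?_) measurableSet_Ioo)
      ((ae_restrict_mem measurableSet_Ioo).mono fun t ht => ?_)
    · exact (hasDerivAt_two_cos_cpow (s - 1)
        (Real.cos_pos_of_mem_Ioo ht)).continuousAt.continuousWithinAt
    · have h0 := Real.cos_pos_of_mem_Ioo ht
      rw [Complex.norm_cpow_eq_rpow_re_of_pos (by positivity), Real.mul_rpow (by norm_num) h0.le]
      simp
  rw [← integrableOn_Icc_iff_integrableOn_Ioo] at hpow
  exact hpow.mul_continuousOn (by fun_prop) isCompact_Icc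

theorem intervalIntegrable_cosKernel {s : ℂ} (hs : 0 < s.re) (x : ℂ) :
    IntervalIntegrable (cosKernel s x) volume (-(Real.pi / 2)) (Real.pi / 2) := by
  rw [intervalIntegrable_iff_integrableOn_Icc_of_le (by linarith [Real.pi_pos])]
  exact integrableOn_cosKernel hs x

theorem continuous_two_cos_cpow {s : ℂ} (hs : 0 < s.re) :
    Continuous (fun t : ℝ => ((2 * Real.cos t : ℝ) : ℂ) ^ s) :=
  continuous_iff_continuousAt.2 fun t =>
    (Complex.continuousAt_ofReal_cpow_const (2 * Real.cos t) s (Or.inl hs)).comp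
      (f := fun t : ℝ => 2 * Real.cos t) (by fun_prop)

theorem cosIntegral_add_two {s : ℂ} (hs : 0 < s.re) (x : ℂ) :
    cosIntegral s x * (s * (s + 1)) =
      cosIntegral (s + 2) x * (((s + 1) / 2 + x) * ((s + 1) / 2 - x)) := by
  have hs2 : 0 < (s + 2).re := by simp; linarith
  have hs0 : s ≠ 0 := by rintro rfl; simp at hs
  have hs1 : s + 1 ≠ 0 := by
    intro h; have := congrArg Complex.re h; simp at this; linarith
  have key := intervalIntegral.integral_eq_sub_of_hasDerivAt_of_le
    (a := -(Real.pi / 2)) (b := Real.pi / 2)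
    -- The Wronskian `u'v - uv'` of `u = (2 cos t)^(s+1)` and `v = e^{2ixt}`. Its derivative is
    -- `u''v - uv''`, and it vanishes at both endpoints because `Re s > 0`.
    (f := fun t : ℝ => ((s + 1) * ((2 * -Real.sin t : ℝ) : ℂ) * ((2 * Real.cos t : ℝ) : ℂ) ^ s
        - 2 * Complex.I * x * ((2 * Real.cos t : ℝ) : ℂ) ^ (s + 1))
        * Complex.exp (2 * Complex.I * x * t))
    (f' := fun t => 4 * (s * (s + 1)) * cosKernel s x t
      - 4 * (((s + 1) / 2 + x) * ((s + 1) / 2 - x)) * cosKernel (s + 2) x t)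
    (by linarith [Real.pi_pos]) ?_ ?_ ?_
  · rw [intervalIntegral.integral_sub ((intervalIntegrable_cosKernel hs x).const_mul _)
      ((intervalIntegrable_cosKernel hs2 x).const_mul _), intervalIntegral.integral_const_mul,
      intervalIntegral.integral_const_mul] at key
    simp only [Real.cos_neg, Real.cos_pi_div_two, mul_zero, Complex.ofReal_zero,
      Complex.zero_cpow hs0, Complex.zero_cpow hs1, sub_zero, zero_mul] at key
    rw [cosIntegral, cosIntegral]
    linear_combination key / 4
  · have h1 := continuous_two_cos_cpow hs
    have h2 : Continuous (fun t : ℝ => ((2 * Real.cos t : ℝ) : ℂ) ^ (s + 1)) :=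
      continuous_two_cos_cpow (by simp; linarith)
    exact Continuous.continuousOn (by fun_prop)
  · intro t ht
    have h0 := Real.cos_pos_of_mem_Ioo ht
    have hne : ((2 * Real.cos t : ℝ) : ℂ) ≠ 0 := by exact_mod_cast (by positivity)
    have hsin : HasDerivAt (fun t : ℝ => ((2 * -Real.sin t : ℝ) : ℂ))
        ((2 * -Real.cos t : ℝ) : ℂ) t := ((Real.hasDerivAt_sin t).neg.const_mul 2).ofReal_comp
    have hd := ((((hsin.const_mul (s + 1)).mul (hasDerivAt_two_cos_cpow s h0)).sub
      ((hasDerivAt_two_cos_cpow (s + 1) h0).const_mul (2 * Complex.I * x))).mul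
      (hasDerivAt_exp_two_I x t))
    convert! hd using 1
    have e1 : ((2 * Real.cos t : ℝ) : ℂ) ^ s
        = ((2 * Real.cos t : ℝ) : ℂ) ^ (s - 1) * (2 * Real.cos t : ℝ) := by
      rw [Complex.cpow_sub _ _ hne, Complex.cpow_one, div_mul_cancel₀ _ hne]
    have e2 : ((2 * Real.cos t : ℝ) : ℂ) ^ (s + 1)
        = ((2 * Real.cos t : ℝ) : ℂ) ^ (s - 1) * (2 * Real.cos t : ℝ) ^ 2 := by
      rw [Complex.cpow_add _ _ hne, Complex.cpow_one, e1]; ring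
    have e3 : (s + 2 - 1) = s + 1 := by ring
    simp only [cosKernel, e3, add_sub_cancel_right, Pi.mul_apply, Pi.sub_apply]
    rw [e1, e2]
    have hcs : (Real.cos t : ℂ) ^ 2 + (Real.sin t : ℂ) ^ 2 = 1 := by
      exact_mod_cast Real.cos_sq_add_sin_sq t
    have hI := Complex.I_sq
    generalize ((2 * Real.cos t : ℝ) : ℂ) ^ (s - 1) = u
    generalize Complex.exp (2 * Complex.I * x * t) = v
    push_cast at *
    generalize Complex.cos (t : ℂ) = c at *
    generalize Complex.sin (t : ℂ) = d at *
    linear_combination -4 * s * (s + 1) * u * v * hcs + 16 * x ^ 2 * c ^ 2 * u * v * hI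
  · exact ((intervalIntegrable_cosKernel hs x).const_mul _).sub
      ((intervalIntegrable_cosKernel hs2 x).const_mul _)

end CosineIntegral

/-! ### Evaluation of Cauchy's beta integral. -/

section CauchyBeta

/-- Reciprocals make the limit valid at the poles too: there `GammaSeq` is eventually `0` (division
by a vanishing product) and `Gamma` has the default value `0`. -/
theorem tendsto_inv_GammaSeq (p : ℂ) :
    Tendsto (fun n => (Complex.GammaSeq p n)⁻¹) atTop (𝓝 (Complex.Gamma p)⁻¹) := by
  by_cases h : Complex.Gamma p = 0
  · obtain ⟨m, rfl⟩ := (Complex.Gamma_eq_zero_iff p).1 h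
    rw [h, inv_zero]
    refine tendsto_const_nhds.congr' ((eventually_ge_atTop m).mono fun n hn => ?_)
    have : ∏ j ∈ Finset.range (n + 1), (-(m : ℂ) + j) = 0 :=
      Finset.prod_eq_zero (Finset.mem_range.2 (Nat.lt_succ_of_le hn)) (by simp)
    simp [Complex.GammaSeq, this]
  · exact (Complex.GammaSeq_tendsto_Gamma p).inv₀ h

theorem prod_range_add_eq_inv_GammaSeq (p : ℂ) {n : ℕ} (hn : n ≠ 0) :
    ∏ j ∈ Finset.range (n + 1), (p + j) =
      (n : ℂ) ^ p * n.factorial * (Complex.GammaSeq p n)⁻¹ := by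
  have h1 : (n : ℂ) ^ p ≠ 0 := by simp [Complex.cpow_eq_zero_iff, hn]
  have h2 : (n.factorial : ℂ) ≠ 0 := by exact_mod_cast n.factorial_ne_zero
  rw [Complex.GammaSeq, inv_div, mul_div_cancel₀ _ (mul_ne_zero h1 h2)]

theorem cosIntegral_add_two_mul {s : ℂ} (hs : 0 < s.re) (x : ℂ) (n : ℕ) :
    cosIntegral s x * (4 ^ n * ((∏ j ∈ Finset.range n, (s / 2 + j)) *
        ∏ j ∈ Finset.range n, ((s + 1) / 2 + j))) =
      cosIntegral (s + 2 * n) x * ((∏ j ∈ Finset.range n, ((s + 1) / 2 + x + j)) *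
        ∏ j ∈ Finset.range n, ((s + 1) / 2 - x + j)) := by
  induction n with
  | zero => simp
  | succ n ih =>
    have h := cosIntegral_add_two (s := s + 2 * n) (by simp; positivity) x
    have e : s + 2 * (n : ℂ) + 2 = s + 2 * ((n + 1 : ℕ) : ℂ) := by push_cast; ring
    rw [e] at h
    simp only [Finset.prod_range_succ, pow_succ]
    linear_combination ((s + 2 * n) * (s + 2 * n + 1)) * ih +
      ((∏ j ∈ Finset.range n, ((s + 1) / 2 + x + j)) *
        ∏ j ∈ Finset.range n, ((s + 1) / 2 - x + j)) * h

/-- The integral of `cos ^ (2n)` over `[-π/2, π/2]`. -/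
noncomputable def cosPowIntegral (n : ℕ) : ℝ :=
  ∫ t in Icc (-(Real.pi / 2)) (Real.pi / 2), Real.cos t ^ (2 * n)

theorem cosIntegral_add_two_mul_eq {s : ℂ} (x : ℂ) (n : ℕ) :
    cosIntegral (s + 2 * n) x =
      4 ^ n * ∫ t in Icc (-(Real.pi / 2)) (Real.pi / 2), Real.cos t ^ (2 * n) • cosKernel s x t := by
  rw [cosIntegral, intervalIntegral.integral_of_le (by linarith [Real.pi_pos]),
    integral_Icc_eq_integral_Ioo, integral_Ioc_eq_integral_Ioo, ← integral_const_mul]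
  refine setIntegral_congr_fun measurableSet_Ioo fun t ht => ?_
  have h0 := Real.cos_pos_of_mem_Ioo ht
  have hne : ((2 * Real.cos t : ℝ) : ℂ) ≠ 0 := by exact_mod_cast (by positivity)
  have e : s + 2 * (n : ℂ) - 1 = (s - 1) + ((2 * n : ℕ) : ℂ) := by push_cast; ring
  simp only [cosKernel, e]
  rw [Complex.cpow_add _ _ hne, Complex.cpow_natCast, Complex.real_smul]
  push_cast
  rw [mul_pow, pow_mul 2]
  norm_num
  ring

/-- Laplace's method: the normalized weights `cos^(2n)` concentrate at their unique maximum `t = 0`,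
where the kernel equals `2^(s-1)`. -/
theorem tendsto_cosIntegral_add_two_mul {s : ℂ} (hs : 0 < s.re) (x : ℂ) :
    Tendsto (fun n : ℕ => cosIntegral (s + 2 * n) x / (4 ^ n * cosPowIntegral n)) atTop
      (𝓝 (2 ^ (s - 1))) := by
  have hpi := Real.pi_pos
  have h := tendsto_setIntegral_pow_smul_of_unique_maximum_of_isCompact_of_integrableOn
    (μ := volume) (s := Icc (-(Real.pi / 2)) (Real.pi / 2)) (x₀ := (0 : ℝ)) (c := Real.cos)
    (g := cosKernel s x) isCompact_Icc Real.continuousOn_cos ?_ ?_ (by simp) ?_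
    (integrableOn_cosKernel hs x)
    (differentiableAt_cosKernel s x (by simp)).continuousAt.continuousWithinAt
  · have h2 := h.comp (tendsto_id.const_mul_atTop' (r := 2) two_pos)
    have h0 : cosKernel s x 0 = 2 ^ (s - 1) := by simp [cosKernel]
    rw [h0] at h2
    refine h2.congr fun n => ?_
    rw [cosIntegral_add_two_mul_eq, mul_div_mul_left _ _ (pow_ne_zero _ (by norm_num))]
    simp only [Function.comp, id, cosPowIntegral, Complex.real_smul, Complex.ofReal_inv]
    exact (div_eq_inv_mul _ _).symm
  · intro y hy hy0
    rw [← Real.cos_abs y]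
    exact Real.cos_lt_cos_of_nonneg_of_le_pi_div_two le_rfl (abs_le.2 hy) (abs_pos.2 hy0)
  · exact fun y hy => Real.cos_nonneg_of_mem_Icc hy
  · rw [interior_Icc, closure_Ioo (by linarith)]
    exact ⟨by linarith, by linarith⟩

theorem cosPowIntegral_pos (n : ℕ) : 0 < cosPowIntegral n := by
  rw [cosPowIntegral, integral_Icc_eq_integral_Ioc,
    ← intervalIntegral.integral_of_le (by linarith [Real.pi_pos])]
  refine intervalIntegral.intervalIntegral_pos_of_pos_on ?_ (fun t ht => ?_)
    (by linarith [Real.pi_pos])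
  · exact Continuous.intervalIntegrable (by fun_prop) _ _
  · exact pow_pos (Real.cos_pos_of_mem_Ioo ht) _

theorem cosIntegral_eq_mul_GammaSeq {s : ℂ} (hs : 0 < s.re) (x : ℂ) {n : ℕ} (hn : n ≠ 0) :
    cosIntegral s x =
      (cosIntegral (s + 2 * (n + 1 : ℕ)) x / (4 ^ (n + 1) * cosPowIntegral (n + 1))) *
      (cosPowIntegral (n + 1) * (n : ℂ) ^ (1 / 2 : ℂ)) *
      (Complex.GammaSeq (s / 2) n * Complex.GammaSeq ((s + 1) / 2) n *
        ((Complex.GammaSeq ((s + 1) / 2 + x) n)⁻¹ *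
          (Complex.GammaSeq ((s + 1) / 2 - x) n)⁻¹)) := by
  have hn' : (n : ℂ) ≠ 0 := by exact_mod_cast hn
  have hcp : ∀ p : ℂ, (n : ℂ) ^ p ≠ 0 := fun p => by simp [Complex.cpow_eq_zero_iff, hn]
  have hf : (n.factorial : ℂ) ≠ 0 := by exact_mod_cast n.factorial_ne_zero
  have hW : (cosPowIntegral (n + 1) : ℂ) ≠ 0 := by
    exact_mod_cast (cosPowIntegral_pos (n + 1)).ne'
  have hG : ∀ p : ℂ, 0 < p.re → Complex.GammaSeq p n ≠ 0 := fun p hp => by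
    rw [Complex.GammaSeq]
    refine div_ne_zero (mul_ne_zero (hcp p) hf) (Finset.prod_ne_zero_iff.2 fun j _ h => ?_)
    have := congrArg Complex.re h
    simp at this
    have hj : (0 : ℝ) ≤ j := j.cast_nonneg
    linarith
  have g1 := hG (s / 2) (by simpa using hs)
  have g2 := hG ((s + 1) / 2) (by simp; linarith)
  have h := cosIntegral_add_two_mul hs x (n + 1)
  rw [prod_range_add_eq_inv_GammaSeq _ hn, prod_range_add_eq_inv_GammaSeq _ hn,
    prod_range_add_eq_inv_GammaSeq _ hn, prod_range_add_eq_inv_GammaSeq _ hn] at h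
  -- The exponents on the left exceed `s/2 + (s+1)/2` by exactly `1/2`; this is the source of the
  -- factor `n^(1/2)`.
  have e : (n : ℂ) ^ ((s + 1) / 2 + x) * (n : ℂ) ^ ((s + 1) / 2 - x) =
      (n : ℂ) ^ (1 / 2 : ℂ) * ((n : ℂ) ^ (s / 2) * (n : ℂ) ^ ((s + 1) / 2)) := by
    rw [← Complex.cpow_add _ _ hn', ← Complex.cpow_add _ _ hn', ← Complex.cpow_add _ _ hn']
    ring_nf
  have c1 := hcp (s / 2)
  have c2 := hcp ((s + 1) / 2)
  generalize (Complex.GammaSeq ((s + 1) / 2 + x) n)⁻¹ = u at *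
  generalize (Complex.GammaSeq ((s + 1) / 2 - x) n)⁻¹ = v at *
  have h4 : (4 : ℂ) ^ (n + 1) ≠ 0 := pow_ne_zero _ (by norm_num)
  generalize (4 : ℂ) ^ (n + 1) = k at *
  generalize Complex.GammaSeq (s / 2) n = w at *
  generalize Complex.GammaSeq ((s + 1) / 2) n = z at *
  generalize cosIntegral (s + 2 * (n + 1 : ℕ)) x = J at *
  generalize (n : ℂ) ^ (1 / 2 : ℂ) = r at *
  generalize (n : ℂ) ^ ((s + 1) / 2) = d at *
  generalize (n : ℂ) ^ (s / 2) = d' at *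
  generalize (n : ℂ) ^ ((s + 1) / 2 + x) = a at *
  generalize (n : ℂ) ^ ((s + 1) / 2 - x) = b at *
  have h2 : (cosIntegral s x * k - J * r * w * z * u * v) * (d * d' * n.factorial ^ 2) = 0 := by
    field_simp at h
    linear_combination n.factorial ^ 2 * h + J * w * z * u * v * n.factorial ^ 2 * e
  have h3 := (mul_eq_zero.1 h2).resolve_right (by positivity)
  field_simp
  linear_combination h3

theorem cosIntegral_one_zero : cosIntegral 1 0 = Real.pi := by
  simp [cosIntegral, cosKernel]

/-- This limit does not depend on `s` and `x`, so it is read off from the case `s = 1`, `x = 0`,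
where the integral is `π`; Wallis' formula is not needed. -/
theorem tendsto_cosPowIntegral_mul_sqrt :
    Tendsto (fun n : ℕ => (cosPowIntegral (n + 1) : ℂ) * (n : ℂ) ^ (1 / 2 : ℂ)) atTop
      (𝓝 (Real.pi / Complex.Gamma (1 / 2))) := by
  have h1 := (tendsto_cosIntegral_add_two_mul (s := 1) (by simp) 0).comp (tendsto_add_atTop_nat 1)
  have h2 := (Complex.GammaSeq_tendsto_Gamma (1 / 2)).mul
    (Complex.GammaSeq_tendsto_Gamma ((1 + 1) / 2)) |>.mul
      ((tendsto_inv_GammaSeq ((1 + 1) / 2 + 0)).mul (tendsto_inv_GammaSeq ((1 + 1) / 2 - 0)))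
  have hG : Complex.Gamma (1 / 2) ≠ 0 := Complex.Gamma_ne_zero_of_re_pos (by norm_num)
  have h3 := (tendsto_const_nhds (x := (Real.pi : ℂ))).div (h1.mul h2) (by simpa using hG)
  have e : (Real.pi : ℂ) / (2 ^ ((1 : ℂ) - 1) * (Complex.Gamma (1 / 2) *
      Complex.Gamma ((1 + 1) / 2) * ((Complex.Gamma ((1 + 1) / 2 + 0))⁻¹ *
      (Complex.Gamma ((1 + 1) / 2 - 0))⁻¹))) = Real.pi / Complex.Gamma (1 / 2) := by
    norm_num
  rw [e] at h3
  refine h3.congr' ((eventually_ne_atTop 0).mono fun n hn => ?_)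
  have h := cosIntegral_eq_mul_GammaSeq (s := 1) (by simp) 0 hn
  rw [cosIntegral_one_zero] at h
  simp only [Pi.div_apply, Function.comp]
  rw [div_eq_iff, h]
  · ring
  · intro h0
    apply Complex.ofReal_ne_zero.2 Real.pi_ne_zero
    rw [h, mul_right_comm, h0, zero_mul]

/-- Cauchy's beta integral. -/
theorem cosIntegral_eq {s : ℂ} (hs : 0 < s.re) (x : ℂ) :
    cosIntegral s x = Real.pi * Complex.Gamma s *
      ((Complex.Gamma ((s + 1) / 2 + x))⁻¹ * (Complex.Gamma ((s + 1) / 2 - x))⁻¹) := by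
  have h1 := (tendsto_cosIntegral_add_two_mul hs x).comp (tendsto_add_atTop_nat 1)
  have h2 := (Complex.GammaSeq_tendsto_Gamma (s / 2)).mul
    (Complex.GammaSeq_tendsto_Gamma ((s + 1) / 2)) |>.mul
      ((tendsto_inv_GammaSeq ((s + 1) / 2 + x)).mul (tendsto_inv_GammaSeq ((s + 1) / 2 - x)))
  have h3 := (h1.mul tendsto_cosPowIntegral_mul_sqrt).mul h2
  have h4 := tendsto_nhds_unique
    ((tendsto_const_nhds (x := cosIntegral s x)).congr' ((eventually_ne_atTop 0).mono fun n hn =>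
      cosIntegral_eq_mul_GammaSeq hs x hn)) h3
  have hdup := Complex.Gamma_mul_Gamma_add_half (s / 2)
  rw [← add_div, mul_div_cancel₀ _ two_ne_zero] at hdup
  rw [h4, hdup, Complex.Gamma_one_half_eq]
  have h5 : (2 : ℂ) ^ (s - 1) * 2 ^ (1 - s) = 1 := by
    rw [← Complex.cpow_add _ _ two_ne_zero]; simp
  have h6 : ((Real.sqrt Real.pi : ℝ) : ℂ) ≠ 0 := by
    exact_mod_cast (Real.sqrt_pos.2 Real.pi_pos).ne'
  have h7 : (Real.pi : ℂ) ^ (1 / 2 : ℂ) = ((Real.sqrt Real.pi : ℝ) : ℂ) := by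
    rw [Real.sqrt_eq_rpow, Complex.ofReal_cpow Real.pi_pos.le]; norm_num
  rw [h7]
  generalize (Complex.Gamma ((s + 1) / 2 + x))⁻¹ * (Complex.Gamma ((s + 1) / 2 - x))⁻¹ = u
  field_simp
  linear_combination (Complex.Gamma s * u) * h5

end CauchyBeta

/-! ### Pochhammer symbols as Gamma quotients, and the terms as integrals. -/

section Pochhammer

theorem ascPochhammer_eval_mul_inv_Gamma (c : ℂ) (n : ℕ) :
    (ascPochhammer ℂ n).eval c * (Complex.Gamma (c + n))⁻¹ = (Complex.Gamma c)⁻¹ := by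
  induction n with
  | zero => simp
  | succ n ih =>
    have h := Complex.one_div_Gamma_eq_self_mul_one_div_Gamma_add_one (c + n)
    rw [ascPochhammer_succ_eval, ← ih, h]
    push_cast
    ring_nf

theorem ascPochhammer_eval_eq_mul_inv_Gamma {a : ℂ} (ha : Complex.Gamma (1 - a) ≠ 0) (n : ℕ) :
    (ascPochhammer ℂ n).eval a =
      (-1) ^ n * (Complex.Gamma (1 - a) * (Complex.Gamma (1 - a - n))⁻¹) := by
  induction n with
  | zero => simp [ha]
  | succ n ih =>
    have h := Complex.one_div_Gamma_eq_self_mul_one_div_Gamma_add_one (1 - a - (n + 1))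
    rw [show 1 - a - ((n : ℂ) + 1) + 1 = 1 - a - n by ring] at h
    rw [ascPochhammer_succ_eval, ih]
    push_cast
    rw [h]
    ring

theorem intPochhammer_eq_Gamma_div_Gamma {c : ℂ} (hc : ∀ m : ℕ, c ≠ -m) (n : ℤ) :
    intPochhammer c n = Complex.Gamma (c + n) / Complex.Gamma c := by
  cases n with
  | ofNat n =>
    have h := ascPochhammer_eval_mul_inv_Gamma c n
    have h0 : Complex.Gamma (c + n) ≠ 0 := Complex.Gamma_ne_zero fun m hm => hc (n + m) (by
      push_cast; linear_combination hm)
    simp only [intPochhammer, Int.ofNat_eq_natCast, Int.cast_natCast]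
    rw [div_eq_mul_inv, ← h, mul_left_comm, mul_inv_cancel₀ h0, mul_one]
  | negSucc n =>
    have h := ascPochhammer_eval_mul_inv_Gamma (c - ((n + 1 : ℕ) : ℂ)) (n + 1)
    rw [sub_add_cancel] at h
    have h0 : Complex.Gamma c ≠ 0 := Complex.Gamma_ne_zero hc
    simp only [intPochhammer]
    rw [(eq_mul_inv_iff_mul_eq₀ (inv_ne_zero h0)).2 h, Int.cast_negSucc, ← sub_eq_add_neg]
    simp [div_eq_mul_inv, mul_comm]

/-- The reflected form is what suits numerator parameters: `a` may be a nonpositive integer, where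
`Γ(a+n)/Γ(a)` is meaningless but `1/Γ(1-a-n)` correctly vanishes. -/
theorem intPochhammer_eq_mul_inv_Gamma {a : ℂ} (ha : ∀ m : ℕ, a ≠ m + 1) (n : ℤ) :
    intPochhammer a n =
      (-1) ^ n * (Complex.Gamma (1 - a) * (Complex.Gamma (1 - a - n))⁻¹) := by
  have h0 : ∀ k : ℕ, Complex.Gamma (1 - a + k) ≠ 0 := fun k => Complex.Gamma_ne_zero fun m hm =>
    ha (k + m) (by push_cast; linear_combination -hm)
  cases n with
  | ofNat n =>
    simpa [intPochhammer] using ascPochhammer_eval_eq_mul_inv_Gamma (by simpa using h0 0) n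
  | negSucc n =>
    have e : 1 - (a - ((n + 1 : ℕ) : ℂ)) = 1 - a + ((n + 1 : ℕ) : ℂ) := by ring
    simp only [intPochhammer]
    rw [ascPochhammer_eval_eq_mul_inv_Gamma (by rw [e]; exact h0 _), e, add_sub_cancel_right,
      Int.cast_negSucc, sub_neg_eq_add, zpow_negSucc, mul_inv, mul_inv, inv_inv,
      mul_comm (Complex.Gamma (1 - a))]

theorem two_cpow_eq_mul_four_zpow (u : ℂ) (n : ℤ) :
    (2 : ℂ) ^ (u + 2 * n) = 2 ^ u * 4 ^ n := by
  rw [Complex.cpow_add _ _ two_ne_zero, mul_comm 2 (n : ℂ), Complex.cpow_int_mul]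
  norm_num [← mul_zpow, mul_comm]

theorem sqrt_pi_ne_zero : ((Real.sqrt Real.pi : ℝ) : ℂ) ≠ 0 := by
  exact_mod_cast (Real.sqrt_pos.2 Real.pi_pos).ne'

theorem intPochhammer_mul_intPochhammer_add_half {c : ℂ} (hc : ∀ m : ℕ, 2 * c ≠ -m) (n : ℤ) :
    intPochhammer c n * intPochhammer (c + 1 / 2) n =
      Complex.Gamma (2 * c + 2 * n) / Complex.Gamma (2 * c) * (4 ^ n)⁻¹ := by
  have hπ := sqrt_pi_ne_zero
  have h1 := Complex.Gamma_mul_Gamma_add_half (c + n)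
  have h2 := Complex.Gamma_mul_Gamma_add_half c
  have hp := two_cpow_eq_mul_four_zpow (1 - 2 * (c + n)) n
  rw [show 1 - 2 * (c + n) + 2 * n = 1 - 2 * c by ring] at hp
  have h3 : Complex.Gamma (2 * c) ≠ 0 := Complex.Gamma_ne_zero hc
  have h4 : (2 : ℂ) ^ (1 - 2 * (c + n)) ≠ 0 := by simp [Complex.cpow_eq_zero_iff]
  have h5 : (4 : ℂ) ^ n ≠ 0 := zpow_ne_zero _ (by norm_num)
  rw [intPochhammer_eq_Gamma_div_Gamma fun m h => hc (2 * m) (by rw [h]; push_cast; ring),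
    intPochhammer_eq_Gamma_div_Gamma fun m h => hc (2 * m + 1)
      (by rw [eq_sub_of_add_eq h]; push_cast; ring), div_mul_div_comm,
    show c + 1 / 2 + n = c + n + 1 / 2 by ring, h1, h2, hp, mul_add]
  rw [mul_add] at h4
  field_simp

theorem intPochhammer_mul_intPochhammer_add_half_of_one_sub {a : ℂ} (ha : ∀ m : ℕ, 2 * a ≠ m + 1)
    (n : ℤ) :
    intPochhammer a n * intPochhammer (a + 1 / 2) n =
      Complex.Gamma (1 - 2 * a) * (Complex.Gamma (1 - 2 * a - 2 * n))⁻¹ * (4 ^ n)⁻¹ := by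
  have hπ := sqrt_pi_ne_zero
  have h1 := Complex.Gamma_mul_Gamma_add_half (1 / 2 - a - n)
  have h2 := Complex.Gamma_mul_Gamma_add_half (1 / 2 - a)
  have hp := two_cpow_eq_mul_four_zpow (2 * a) n
  have hs : ((-1 : ℂ) ^ n) * (-1) ^ n = 1 := by
    rw [← mul_zpow]; simp
  have h4 : (2 : ℂ) ^ (2 * a) ≠ 0 := by simp [Complex.cpow_eq_zero_iff]
  have h5 : (4 : ℂ) ^ n ≠ 0 := zpow_ne_zero _ (by norm_num)
  rw [show 1 / 2 - a - n + 1 / 2 = 1 - a - n by ring,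
    show 2 * (1 / 2 - a - n) = 1 - 2 * a - 2 * n by ring,
    show 1 - (1 - 2 * a - 2 * n) = 2 * a + 2 * n by ring, hp] at h1
  rw [show 1 / 2 - a + 1 / 2 = 1 - a by ring,
    show 2 * (1 / 2 - a) = 1 - 2 * a by ring,
    show 1 - (1 - 2 * a) = 2 * a by ring] at h2
  rw [intPochhammer_eq_mul_inv_Gamma fun m h => ha (2 * m + 1) (by rw [h]; push_cast; ring),
    intPochhammer_eq_mul_inv_Gamma fun m h => ha (2 * m)
      (by rw [eq_sub_of_add_eq h]; push_cast; ring),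
    show 1 - (a + 1 / 2) = 1 / 2 - a by ring]
  calc _ = ((-1 : ℂ) ^ n * (-1) ^ n) * (Complex.Gamma (1 / 2 - a) * Complex.Gamma (1 - a)) *
        (Complex.Gamma (1 / 2 - a - n) * Complex.Gamma (1 - a - n))⁻¹ := by
        rw [mul_inv]; ring
    _ = _ := by
        rw [hs, h1, h2]
        simp only [mul_inv]
        field_simp

theorem bilateralTerm_eq_cosIntegral {a c : ℂ} (ha : ∀ m : ℕ, 2 * a ≠ (m : ℂ) + 1)
    (hc : ∀ m : ℕ, 2 * c ≠ -(m : ℂ)) (hac : a.re < c.re) (n : ℤ) :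
    bilateralTerm a (a + 1 / 2) c (c + 1 / 2) (-1) n =
      Complex.Gamma (2 * c) * Complex.Gamma (1 - 2 * a) /
        (Real.pi * Complex.Gamma (2 * c - 2 * a)) *
        ((-1) ^ n * cosIntegral (2 * c - 2 * a) ((2 * c + 2 * a - 1) / 2 + 2 * n)) := by
  have hs : 0 < (2 * c - 2 * a).re := by simp; linarith
  have hπ : (Real.pi : ℂ) ≠ 0 := by exact_mod_cast Real.pi_ne_zero
  have hG := Complex.Gamma_ne_zero_of_re_pos hs
  have h5 : (4 : ℂ) ^ n ≠ 0 := zpow_ne_zero _ (by norm_num)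
  rw [bilateralTerm, intPochhammer_mul_intPochhammer_add_half hc,
    intPochhammer_mul_intPochhammer_add_half_of_one_sub ha, cosIntegral_eq hs,
    show (2 * c - 2 * a + 1) / 2 + ((2 * c + 2 * a - 1) / 2 + 2 * n) = 2 * c + 2 * n by ring,
    show (2 * c - 2 * a + 1) / 2 - ((2 * c + 2 * a - 1) / 2 + 2 * n) = 1 - 2 * a - 2 * n by ring,
    mul_div_mul_right _ _ (inv_ne_zero h5), div_div_eq_mul_div]
  rw [← mul_sub] at hG ⊢
  field_simp

end Pochhammer

/-! ### Summation of the alternating Fourier coefficients. -/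

section FourierSum

/-- At a zero of `h` the quotient tends to `F'/h'`, so it is bounded nearby; elsewhere `1/h` is
locally continuous. Compactness globalizes this. -/
theorem integrableOn_div_of_simple_zeros {F h : ℝ → ℂ} {K : Set ℝ} (hK : IsCompact K)
    (hF : IntegrableOn F K) (hh : Continuous h)
    (hz : ∀ t ∈ K, h t = 0 → F t = 0 ∧ DifferentiableAt ℝ F t ∧ ∃ h', h' ≠ 0 ∧ HasDerivAt h h' t) :
    IntegrableOn (fun t => F t / h t) K := by
  refine LocallyIntegrableOn.integrableOn_isCompact (fun t ht => ?_) hK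
  by_cases h0 : h t = 0
  · obtain ⟨hF0, hFd, h', hne, hhd⟩ := hz t ht h0
    have hlim : Tendsto (fun u => F u / h u) (𝓝[K \ {t}] t) (𝓝 (deriv F t / h')) := by
      have h1 := (hasDerivAt_iff_tendsto_slope.1 hFd.hasDerivAt).div
        (hasDerivAt_iff_tendsto_slope.1 hhd) hne
      refine (h1.congr' ?_).mono_left (nhdsWithin_mono _ fun u hu => hu.2)
      filter_upwards [self_mem_nhdsWithin] with u hu
      have hu' : ((u - t : ℝ) : ℂ)⁻¹ ≠ 0 := inv_ne_zero
        (Complex.ofReal_ne_zero.2 (sub_ne_zero.2 hu))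
      simp only [Pi.div_apply, slope, vsub_eq_sub, hF0, h0, sub_zero, Complex.real_smul,
        Complex.ofReal_inv]
      rw [mul_div_mul_left _ _ hu']
    have hmeas : StronglyMeasurableAtFilter (fun u => F u / h u) (𝓝[K \ {t}] t) :=
      ⟨K, mem_of_superset self_mem_nhdsWithin sdiff_subset,
        (hF.aestronglyMeasurable.aemeasurable.div hh.aemeasurable).aestronglyMeasurable⟩
    have := (hK.measurableSet.diff (measurableSet_singleton t)).nhdsWithin_isMeasurablyGenerated t
    obtain ⟨u, hu, hint⟩ := (volume.finiteAt_nhdsWithin t (K \ {t})).integrableAtFilter_of_tendsto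
      hmeas hlim
    refine ⟨u ∪ {t}, ?_, hint.union (by simp)⟩
    have : K ⊆ insert t (K \ {t}) := by simp
    refine nhdsWithin_mono _ this ?_
    rw [nhdsWithin_insert]
    exact ⟨by simp, mem_of_superset hu subset_union_left⟩
  · obtain ⟨ε, hε, hball⟩ := Metric.nhds_basis_closedBall.mem_iff.1
      (hh.continuousAt.eventually_ne h0)
    refine ⟨K ∩ Metric.closedBall t ε, inter_mem_nhdsWithin _ (Metric.closedBall_mem_nhds _ hε), ?_⟩
    simp only [div_eq_mul_inv]
    exact (hF.mono_set inter_subset_left).mul_continuousOn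
      (hh.continuousOn.inv₀ fun u hu => hball hu.2) (hK.inter_right Metric.isClosed_closedBall)

theorem tendsto_integral_mul_exp_four_I (g : ℝ → ℂ) (a b : ℝ) {l : Filter ℤ}
    (hl : Tendsto (fun n : ℤ => (n : ℝ)) l (cocompact ℝ)) :
    Tendsto (fun n : ℤ => ∫ t in Ioc a b, g t * Complex.exp (4 * Complex.I * n * t)) l (𝓝 0) := by
  -- `Real.fourierChar` has period 1, so frequency `-(2/π) n` there corresponds to `e^{4int}` here.
  have hpi := Real.pi_ne_zero
  have hw : Tendsto (fun n : ℤ => -(2 / Real.pi) * (n : ℝ)) l (cocompact ℝ) :=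
    (tendsto_cocompact_mul_left₀ (by simp)).comp hl
  refine ((Real.tendsto_integral_exp_smul_cocompact ((Ioc a b).indicator g)).comp hw).congr
    fun n => ?_
  rw [← integral_indicator measurableSet_Ioc, Function.comp]
  refine integral_congr_ae (Eventually.of_forall fun t => ?_)
  by_cases ht : t ∈ Ioc a b
  · simp only [indicator_of_mem ht, Circle.smul_def, Real.fourierChar_apply, smul_eq_mul]
    rw [mul_comm]
    congr 2
    push_cast
    field_simp
    ring
  · simp [indicator_of_notMem ht]

theorem integral_exp_two_I (k : ℤ) :
    ∫ t in (-(Real.pi / 2))..(Real.pi / 2), Complex.exp (2 * Complex.I * k * t) =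
      if k = 0 then (Real.pi : ℂ) else 0 := by
  split_ifs with hk
  · simp [hk]
  · have hk' : (2 * Complex.I * k : ℂ) ≠ 0 := by simp [hk]
    rw [integral_exp_mul_complex hk', div_eq_zero_iff, sub_eq_zero]
    left
    rw [Complex.exp_eq_exp_iff_exists_int]
    exact ⟨k, by push_cast; ring⟩

theorem cosKernel_add_two_mul (s x : ℂ) (n : ℤ) (t : ℝ) :
    cosKernel s (x + 2 * n) t = cosKernel s x t * Complex.exp (4 * Complex.I * n * t) := by
  rw [cosKernel, cosKernel, mul_assoc (_ ^ _), ← Complex.exp_add]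
  ring_nf

theorem exp_four_I_eq_neg_one {t : ℝ} (ht : t ∈ Icc (-(Real.pi / 2)) (Real.pi / 2))
    (h : 1 + Complex.exp (4 * Complex.I * t) = 0) : t = Real.pi / 4 ∨ t = -(Real.pi / 4) := by
  have h1 : Complex.exp (4 * Complex.I * t) = Complex.exp (Real.pi * Complex.I) := by
    rw [Complex.exp_pi_mul_I]; linear_combination h
  obtain ⟨k, hk⟩ := Complex.exp_eq_exp_iff_exists_int.1 h1
  have h2 : 4 * t = Real.pi + k * (2 * Real.pi) := by
    have := congrArg Complex.im hk
    simpa using this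
  have hpi := Real.pi_pos
  obtain ⟨ht1, ht2⟩ := ht
  have hk1 : (-2 : ℝ) < k := by
    by_contra! hc
    nlinarith
  have hk2 : (k : ℝ) < 1 := by
    by_contra! hc
    nlinarith
  have hk1' : -2 < k := by exact_mod_cast hk1
  have hk2' : k < 1 := by exact_mod_cast hk2
  obtain rfl | rfl : k = 0 ∨ k = -1 := by omega
  · left; push_cast at h2; linarith
  · right; push_cast at h2; linarith

theorem exp_two_I_pi_div_four : Complex.exp (2 * Complex.I * (Real.pi / 4 : ℝ)) = Complex.I := by
  rw [show (2 * Complex.I * (Real.pi / 4 : ℝ) : ℂ) = Real.pi / 2 * Complex.I by push_cast; ring]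
  exact Complex.exp_pi_div_two_mul_I

theorem exp_two_I_neg_pi_div_four :
    Complex.exp (2 * Complex.I * (-(Real.pi / 4) : ℝ)) = -Complex.I := by
  rw [show (2 * Complex.I * (-(Real.pi / 4) : ℝ) : ℂ) = -Real.pi / 2 * Complex.I by
    push_cast; ring]
  exact Complex.exp_neg_pi_div_two_mul_I

theorem exists_integrable_quotient {f : ℝ → ℂ}
    (hf : IntegrableOn f (Icc (-(Real.pi / 2)) (Real.pi / 2)))
    (hf1 : DifferentiableAt ℝ f (Real.pi / 4)) (hf2 : DifferentiableAt ℝ f (-(Real.pi / 4))) :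
    ∃ (B : ℂ) (g : ℝ → ℂ), IntegrableOn g (Icc (-(Real.pi / 2)) (Real.pi / 2)) ∧
      ∀ t ∈ Icc (-(Real.pi / 2)) (Real.pi / 2), f t =
        (f (Real.pi / 4) + f (-(Real.pi / 4))) / 2 + B * Complex.exp (2 * Complex.I * t) +
          g t * (1 + Complex.exp (4 * Complex.I * t)) := by
  -- `A + B e^{2it}` interpolates `f` at `±π/4`, the zeros of `1 + e^{4it}`, where `e^{2it} = ±i`.
  set A := (f (Real.pi / 4) + f (-(Real.pi / 4))) / 2 with hA
  set B := (f (Real.pi / 4) - f (-(Real.pi / 4))) / (2 * Complex.I) with hB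
  set F : ℝ → ℂ := fun t => f t - (A + B * Complex.exp (2 * Complex.I * t)) with hFdef
  have hBI : B * Complex.I = (f (Real.pi / 4) - f (-(Real.pi / 4))) / 2 := by
    rw [hB]; field_simp
  have hexp : ∀ t : ℝ, DifferentiableAt ℝ
      (fun t : ℝ => A + B * Complex.exp (2 * Complex.I * t)) t := fun t => by fun_prop
  have hz1 : F (Real.pi / 4) = 0 := by
    simp only [hFdef]
    rw [exp_two_I_pi_div_four, hBI, hA]; ring
  have hz2 : F (-(Real.pi / 4)) = 0 := by
    simp only [hFdef]
    rw [exp_two_I_neg_pi_div_four, mul_neg, hBI, hA]; ring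
  have hzero : ∀ t ∈ Icc (-(Real.pi / 2)) (Real.pi / 2),
      1 + Complex.exp (4 * Complex.I * t) = 0 → F t = 0 := fun t ht h => by
    obtain rfl | rfl := exp_four_I_eq_neg_one ht h
    · exact hz1
    · exact hz2
  refine ⟨B, fun t => F t / (1 + Complex.exp (4 * Complex.I * t)),
    integrableOn_div_of_simple_zeros isCompact_Icc
      (hf.sub (Continuous.integrableOn_Icc (by fun_prop))) (by fun_prop) fun t ht h => ?_,
    fun t ht => ?_⟩
  · refine ⟨hzero t ht h, ?_, Complex.exp (4 * Complex.I * t) * (4 * Complex.I), ?_, ?_⟩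
    · obtain rfl | rfl := exp_four_I_eq_neg_one ht h
      · exact hf1.sub (hexp _)
      · exact hf2.sub (hexp _)
    · simp
    · have h := ((hasDerivAt_id t).ofReal_comp.const_mul (4 * Complex.I)).cexp
      simpa using h.const_add 1
  · by_cases h : 1 + Complex.exp (4 * Complex.I * t) = 0
    · have h1 := hzero t ht h
      simp only [hFdef] at h1
      rw [h]
      linear_combination h1
    · rw [div_mul_cancel₀ _ h]
      simp only [hFdef]
      ring

theorem tendsto_intCast_cocompact_atTop : Tendsto (fun n : ℤ => (n : ℝ)) atTop (cocompact ℝ) :=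
  tendsto_intCast_atTop_atTop.mono_right atTop_le_cocompact

theorem tendsto_intCast_cocompact_atBot : Tendsto (fun n : ℤ => (n : ℝ)) atBot (cocompact ℝ) :=
  (tendsto_intCast_atBot_iff.2 tendsto_id).mono_right atBot_le_cocompact

theorem hasSum_conditional_of_telescope {u G : ℤ → ℂ} {S : ℂ}
    (h : ∀ n, u n = (if n = 0 then S else 0) + (G n - G (n + 1)))
    (hbot : Tendsto G atBot (𝓝 0)) (htop : Tendsto G atTop (𝓝 0)) :
    HasSum u S (SummationFilter.conditional ℤ) := by
  rw [HasSum, SummationFilter.conditional_filter, tendsto_map'_iff]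
  -- Starting at `N = M - 1` makes the base case an empty sum.
  have htel : ∀ M : ℤ, ∀ N ≥ M - 1, ∑ n ∈ Finset.Icc M N, (G n - G (n + 1)) = G M - G (N + 1) := by
    intro M N hN
    induction N, hN using Int.leInduction with
    | base => simp
    | succ N hN ih =>
      have : Finset.Icc M (N + 1) = insert (N + 1) (Finset.Icc M N) := by
        ext k; simp; omega
      rw [this, Finset.sum_insert (by simp), ih]
      ring
  have hlim : Tendsto (fun p : ℤ × ℤ => S + (G p.1 - G (p.2 + 1))) (atBot ×ˢ atTop) (𝓝 S) := by
    have h1 : Tendsto (fun N : ℤ => G (N + 1)) atTop (𝓝 0) :=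
      htop.comp (tendsto_atTop_add_const_right _ _ tendsto_id)
    simpa using ((hbot.comp tendsto_fst).sub (h1.comp tendsto_snd)).const_add S
  refine hlim.congr' ?_
  filter_upwards [prod_mem_prod (Iic_mem_atBot (0 : ℤ)) (Ici_mem_atTop (0 : ℤ))] with p hp
  obtain ⟨h1, h2⟩ := hp
  simp only [mem_Iic, mem_Ici] at h1 h2
  simp only [Function.comp, h, Finset.sum_add_distrib]
  rw [htel _ _ (by omega), Finset.sum_ite_eq', if_pos (Finset.mem_Icc.2 ⟨h1, h2⟩)]

theorem hasSum_cosIntegral {s : ℂ} (hs : 0 < s.re) (x : ℂ) :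
    HasSum (fun n : ℤ => (-1) ^ n * cosIntegral s (x + 2 * n))
      (Real.pi * ((cosKernel s x (Real.pi / 4) + cosKernel s x (-(Real.pi / 4))) / 2))
      (SummationFilter.conditional ℤ) := by
  have hpi := Real.pi_pos
  have hcos : 0 < Real.cos (Real.pi / 4) :=
    Real.cos_pos_of_mem_Ioo ⟨by linarith, by linarith⟩
  obtain ⟨B, g, hg, hfg⟩ := exists_integrable_quotient (integrableOn_cosKernel hs x)
    (differentiableAt_cosKernel s x hcos) (differentiableAt_cosKernel s x (by simp))
  set A := (cosKernel s x (Real.pi / 4) + cosKernel s x (-(Real.pi / 4))) / 2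
  have hle : -(Real.pi / 2) ≤ Real.pi / 2 := by linarith
  have hgi : ∀ n : ℤ, IntervalIntegrable (fun t : ℝ => g t * Complex.exp (4 * Complex.I * n * t))
      volume (-(Real.pi / 2)) (Real.pi / 2) := fun n => by
    rw [intervalIntegrable_iff_integrableOn_Icc_of_le hle]
    exact hg.mul_continuousOn (by fun_prop) isCompact_Icc
  -- The sign turns the sum of consecutive coefficients produced by `1 + e^{4it}` into the
  -- difference `G n - G (n + 1)`.
  set G : ℤ → ℂ := fun n => (-1) ^ n *
    ∫ t in Ioc (-(Real.pi / 2)) (Real.pi / 2), g t * Complex.exp (4 * Complex.I * n * t) with hG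
  have hGlim : ∀ {l : Filter ℤ}, Tendsto (fun n : ℤ => (n : ℝ)) l (cocompact ℝ) →
      Tendsto G l (𝓝 0) := fun hl => by
    rw [tendsto_zero_iff_norm_tendsto_zero]
    simpa only [hG, norm_mul, norm_zpow, norm_neg, norm_one, one_zpow, one_mul, norm_zero] using
      (tendsto_integral_mul_exp_four_I g _ _ hl).norm
  refine hasSum_conditional_of_telescope (G := G) (fun n => ?_)
    (hGlim tendsto_intCast_cocompact_atBot) (hGlim tendsto_intCast_cocompact_atTop)
  have hE : ∀ k : ℤ, IntervalIntegrable (fun t : ℝ => Complex.exp (2 * Complex.I * k * t))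
      volume (-(Real.pi / 2)) (Real.pi / 2) := fun k =>
    Continuous.intervalIntegrable (by fun_prop) _ _
  have hint : cosIntegral s (x + 2 * n) =
      A * (∫ t in (-(Real.pi / 2))..(Real.pi / 2),
        Complex.exp (2 * Complex.I * (2 * n : ℤ) * t)) +
      B * (∫ t in (-(Real.pi / 2))..(Real.pi / 2),
        Complex.exp (2 * Complex.I * (2 * n + 1 : ℤ) * t)) +
      ((∫ t in (-(Real.pi / 2))..(Real.pi / 2), g t * Complex.exp (4 * Complex.I * n * t)) +
      ∫ t in (-(Real.pi / 2))..(Real.pi / 2),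
        g t * Complex.exp (4 * Complex.I * (n + 1 : ℤ) * t)) := by
    rw [← intervalIntegral.integral_const_mul, ← intervalIntegral.integral_const_mul,
      ← intervalIntegral.integral_add ((hE _).const_mul _) ((hE _).const_mul _),
      ← intervalIntegral.integral_add (hgi _) (hgi _),
      ← intervalIntegral.integral_add (((hE _).const_mul _).add ((hE _).const_mul _))
        ((hgi _).add (hgi _)), cosIntegral]
    refine intervalIntegral.integral_congr fun t ht => ?_
    rw [uIcc_of_le hle] at ht
    have e1 : Complex.exp (2 * Complex.I * (2 * n : ℤ) * t) =
        Complex.exp (4 * Complex.I * n * t) := by push_cast; ring_nf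
    have e2 : Complex.exp (2 * Complex.I * (2 * n + 1 : ℤ) * t) =
        Complex.exp (4 * Complex.I * n * t) * Complex.exp (2 * Complex.I * t) := by
      rw [← Complex.exp_add]; push_cast; ring_nf
    have e3 : Complex.exp (4 * Complex.I * (n + 1 : ℤ) * t) =
        Complex.exp (4 * Complex.I * n * t) * Complex.exp (4 * Complex.I * t) := by
      rw [← Complex.exp_add]; push_cast; ring_nf
    simp only [cosKernel_add_two_mul]
    rw [hfg t ht, e1, e2, e3]
    ring
  -- The `B` term has odd frequency index, so its integral over the full period `π` of `e^{2it}`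
  -- always vanishes.
  have hodd : 2 * n + 1 ≠ 0 := by omega
  rw [hint, integral_exp_two_I, integral_exp_two_I, if_neg hodd,
    intervalIntegral.integral_of_le hle, intervalIntegral.integral_of_le hle]
  simp only [hG, zpow_add_one₀ (show (-1 : ℂ) ≠ 0 by norm_num)]
  by_cases hn : n = 0
  · simp only [hn, if_true, mul_zero, zpow_zero]
    ring
  · simp only [hn, if_false, show 2 * n ≠ 0 by omega, mul_zero]
    ring

/-- Here `2 cos(π/4) = √2`, and the two exponentials `e^{±iπx/2}` average to a cosine. -/
theorem cosKernel_pi_div_four_add (s x : ℂ) :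
    (cosKernel s x (Real.pi / 4) + cosKernel s x (-(Real.pi / 4))) / 2 =
      2 ^ ((s - 1) / 2) * Complex.cos (x / 2 * Real.pi) := by
  have h : ((2 * Real.cos (Real.pi / 4) : ℝ) : ℂ) ^ (s - 1) = 2 ^ ((s - 1) / 2) := by
    rw [Real.cos_pi_div_four, mul_div_cancel₀ _ two_ne_zero,
      Complex.cpow_def_of_ne_zero (by simp), Complex.cpow_def_of_ne_zero two_ne_zero,
      ← Complex.ofReal_log (Real.sqrt_nonneg _), Real.log_sqrt zero_le_two]
    rw [Complex.ofReal_div, Complex.ofReal_log zero_le_two]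
    push_cast
    ring_nf
  rw [cosKernel, cosKernel, Real.cos_neg, h, Complex.cos]
  push_cast
  ring_nf

end FourierSum

theorem mainTheorem2 (a c : ℂ)
    (ha : ∀ m : ℕ, 2 * a ≠ (m : ℂ) + 1)
    (hc : ∀ m : ℕ, 2 * c ≠ -(m : ℂ))
    (hac : a.re < c.re) :
    Summable (bilateralTerm a (a + 1 / 2) c (c + 1 / 2) (-1)) (SummationFilter.conditional ℤ) ∧
      bilateralH a (a + 1 / 2) c (c + 1 / 2) (-1) =
        Complex.Gamma (2 * c) * Complex.Gamma (1 - 2 * a) / Complex.Gamma (2 * c - 2 * a) *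
          (2 : ℂ) ^ (c - a - 1 / 2) *
          Complex.cos ((2 * c + 2 * a - 1) / 4 * (Real.pi : ℂ)) := by
  have hs : 0 < (2 * c - 2 * a).re := by simp; linarith
  have hπ : (Real.pi : ℂ) ≠ 0 := by exact_mod_cast Real.pi_ne_zero
  have h := (hasSum_cosIntegral hs ((2 * c + 2 * a - 1) / 2)).mul_left
    (Complex.Gamma (2 * c) * Complex.Gamma (1 - 2 * a) /
      (Real.pi * Complex.Gamma (2 * c - 2 * a)))
  simp only [← bilateralTerm_eq_cosIntegral ha hc hac] at h
  refine ⟨h.summable, ?_⟩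
  rw [bilateralH, h.tsum_eq, cosKernel_pi_div_four_add,
    show (2 * c - 2 * a - 1) / 2 = c - a - 1 / 2 by ring,
    show (2 * c + 2 * a - 1) / 2 / 2 = (2 * c + 2 * a - 1) / 4 by ring]
  field_simp
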